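/- Let $d\ge 1$, and let $n_1,\dots,n_d\ge 2$ and $r_1,\dots,r_d\ge 2$ be integers with $n_1r_1\le n_2r_2\le\cdots\le n_dr_d$. Put $n=\prod_i n_i$, $r=\prod_i r_i$, $N_i=\prod_{j=d-i+1}^d n_j$, $R_i=\prod_{j=d-i+1}^d r_j$, and assume $n\ge r$. Let $P$ be an integer with $1\le P\le nr$. The Multi-TTM of an $n_1\times\cdots\times n_d$ tensor $X$ with matrices $A^{(k)}$ of size $n_k\times r_k$ is the $r_1\times\cdots\times r_d$ tensor $$Y(j)=\sum_{i} X(i)\prod_{k=1}^d A^{(k)}(i_k,j_k).$$ *Lower bound.* Put $$\mathrm{O}=\frac{n+r+\sum_{k} n_kr_k}{P},\qquad B=\begin{cases} r+\frac nP & \text{if } P<\frac nr,\\ 2\left(\frac{nr}{P}\right)^{1/2} & \text{if } \frac nr\le P,\end{cases}\qquad A=\sum_{j=1}^{d-I}n_jr_j+I\left(\frac{N_IR_I}{P}\right)^{1/I},$$ where, with $T_i=N_iR_i/(n_{d-i}r_{d-i})^i$ for $1\le i\le d-1$, the index $I\in\{1,\dots,d\}$ is determined by $T_{I-1}\le P$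 (if $I\ge 2$) and $P<T_I$ (if $I\le d-1$). Let $\mathrm{LB}=A+B-\mathrm{O}$. *Algorithms.* In a parallel atomic Multi-TTM algorithm on $P$ processors, each of the $nr$ terms $X(i)\prod_k A^{(k)}(i_k,j_k)$ is computed as a whole on one processor, which then must hold its $d+1$ factors; processors may add partial sums of the same entry of $Y$ that they hold, and send entries of the inputs or partial sums of entries of $Y$ that they hold to each other. Each input entry is initially owned by exactly one processor, and each entry of $Y$ is in the end owned by exactly one processor. The algorithm is load balanced if each processor computes exactly $nr/P$ terms. *The grid algorithm.* Arrange $P=pq$ processors, $p=\prod_k p_k$, $q=\prod_k q_k$, in a $p_1\times\cdots\times p_d\times q_1\times\cdots\times q_d$ grid, where $p_k\mid n_k$ and $q_k\mid r_k$, and cut the $k$-th index range of $X$ into $p_k$ and that of $Y$ into $q_k$ equal consecutive blocks. Processor $(p'_1,\dots,p'_d,q'_1,\dots,q'_d)$ obtains the subtensor $X_{p'_1\cdots p'_d}$ by an All-Gather over the processors $(p'_1,\dots,p'_d,*,\dots,*)$; for each $k$ it obtains the submatrix $A^{(k)}_{p'_kq'_k}$ by an All-Gather over the processors with the same $p'_k$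 and $q'_k$; it computes the Multi-TTM of these data; and the results are summed into $Y_{q'_1\cdots q'_d}$ by a Reduce-Scatter over the processors $(*,\dots,*,q'_1,\dots,q'_d)$. Either collective on $Q$ processors has bandwidth cost $(1-\frac1Q)w$, where $w$ is the number of words on each processor after the All-Gather or before the Reduce-Scatter; the bandwidth cost of the algorithm is the sum of the costs of its $d+2$ collectives. For real $p_k,q_k\ge 1$ with $pq=P$ define, accordingly, $$C(p_1,\dots,p_d,q_1,\dots,q_d)=\Big(1-\frac pP\Big)\frac np+\sum_{k=1}^d\Big(1-\frac{p_kq_k}{P}\Big)\frac{n_kr_k}{p_kq_k}+\Big(1-\frac qP\Big)\frac rq .$$ **Theorem.** 1. In every load balanced parallel atomic Multi-TTM algorithm on $P$ processors some processor sends or receives at least $\mathrm{LB}$ words in total. 2. For all positive integers $p_k\mid n_k$, $q_k\mid r_k$ with $pq=P$, the grid algorithm computes $Y$, computes each term on exactly one processor, computes $nr/P$ terms on each processor, and has bandwidth cost $C(p_1,\dots,p_d,q_1,\dots,q_d)$. 3. There exist real numbers $1\le p_k\le n_k$ and $1\le q_k\le r_k$ $(1\le k\le d)$ with $pq=P$ such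 that $$C(p_1,\dots,p_d,q_1,\dots,q_d)=\frac np+\frac rq+\sum_{k=1}^d\frac{n_kr_k}{p_kq_k}-\mathrm{O}\ \le\ 3\,\mathrm{LB}.$$ Thus, integrality of the grid aside, the grid algorithm is communication optimal up to a factor of $3$. -/

import Mathlib

namespace MultiTTM

/-! Throughout, a mode is an element of `Fin d`; the modes `1, …, d` of the text are
`0, …, d - 1` here. `n k` and `r k` are the sizes of the input and output tensor in mode `k`. -/

/-- Index of an entry of a tensor of size `n 0 × ⋯ × n (d - 1)`. -/
abbrev Idx {d : ℕ} (n : Fin d → ℕ) : Type := ∀ k : Fin d, Fin (n k)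

/-- The Multi-TTM `X ×₁ A₁ᵀ ⋯ ×_d A_dᵀ`. -/
noncomputable def multiTTM {d : ℕ} {n r : Fin d → ℕ} (X : Idx n → ℝ)
    (A : ∀ k : Fin d, Matrix (Fin (n k)) (Fin (r k)) ℝ) : Idx r → ℝ :=
  fun j => ∑ i : Idx n, X i * ∏ k, A k (i k) (j k)

/-! ### Parallel atomic algorithms -/

/-- The words that processors can hold and communicate: the entries of the input tensor, the
entries of the input matrices, and partial sums of entries of the output tensor. `part j S` is the
value `∑ i ∈ S, X i * ∏ k, A k (i k) (j k)`. -/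
inductive Word {d : ℕ} (n r : Fin d → ℕ) : Type
  | x (i : Idx n) : Word n r
  | a (k : Fin d) (i : Fin (n k)) (j : Fin (r k)) : Word n r
  | part (j : Idx r) (S : Finset (Idx n)) : Word n r

/-- One word sent by the processor `src` and received by the processor `dst`. -/
structure Message {d : ℕ} (n r : Fin d → ℕ) (P : ℕ) where
  src : Fin P
  dst : Fin P
  word : Word n r

/-- What is fixed before the run of an atomic Multi-TTM algorithm on `P` processors: the
processor that owns each entry (exactly one copy of each input entry at the start and of each output
entry at the end), and, for each of the terms `X i * ∏ k, A k (i k) (j k)`, the one processor on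
which it is computed. -/
structure Layout {d : ℕ} (n r : Fin d → ℕ) (P : ℕ) where
  ownerX : Idx n → Fin P
  ownerA : ∀ k : Fin d, Fin (n k) → Fin (r k) → Fin P
  ownerY : Idx r → Fin P
  proc : Idx n → Idx r → Fin P

namespace Layout

variable {d : ℕ} {n r : Fin d → ℕ} {P : ℕ}

/-- The words that processor `s` holds at the start. -/
def initial (L : Layout n r P) (s : Fin P) : Set (Word n r) :=
  {w | (∃ i, L.ownerX i = s ∧ w = .x i) ∨ (∃ k i j, L.ownerA k i j = s ∧ w = .a k i j)}

/-- `L.Run T M`: the processors can reach the state in which each processor `s` has held the words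
`M s`, the messages exchanged so far being `T` (latest first). A step is the atomic computation of
one term on its processor, a local addition of two partial sums, or a message. -/
inductive Run (L : Layout n r P) : List (Message n r P) → (Fin P → Set (Word n r)) → Prop
  | start : Run L [] L.initial
  | compute {T M} (i : Idx n) (j : Idx r) (h : Run L T M)
      (hx : Word.x i ∈ M (L.proc i j))
      (ha : ∀ k, Word.a k (i k) (j k) ∈ M (L.proc i j)) :
      Run L T (Function.update M (L.proc i j) (insert (Word.part j {i}) (M (L.proc i j))))
  | add {T M} (s : Fin P) (j : Idx r) (S₁ S₂ : Finset (Idx n)) (h : Run L T M)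
      (h₁ : Word.part j S₁ ∈ M s) (h₂ : Word.part j S₂ ∈ M s) (hS : Disjoint S₁ S₂) :
      Run L T (Function.update M s (insert (Word.part j (S₁.disjUnion S₂ hS)) (M s)))
  | send {T M} (src dst : Fin P) (w : Word n r) (h : Run L T M) (hne : src ≠ dst)
      (hw : w ∈ M src) :
      Run L (⟨src, dst, w⟩ :: T) (Function.update M dst (insert w (M dst)))

/-- The messages `T` are those of a complete run: at its end every output entry is held by its
owner. -/
def Computes (L : Layout n r P) (T : List (Message n r P)) : Prop :=
  ∃ M, L.Run T M ∧ ∀ j, Word.part j Finset.univ ∈ M (L.ownerY j)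

/-- Every processor computes exactly `1 / P` of the terms. -/
def LoadBalanced (L : Layout n r P) : Prop :=
  ∀ s : Fin P, (Finset.univ.filter fun t : Idx n × Idx r => L.proc t.1 t.2 = s).card * P =
    (∏ k, n k) * ∏ k, r k

end Layout

/-- The number of words that processor `s` sends or receives. -/
def traffic {d : ℕ} {n r : Fin d → ℕ} {P : ℕ} (T : List (Message n r P)) (s : Fin P) : ℕ :=
  T.countP fun m => decide (m.src = s ∨ m.dst = s)

/-! ### The lower bound -/

section LowerBound

variable {d : ℕ} (n r : Fin d → ℕ) (P : ℕ)

/-- Product of the `i` rightmost terms (`N_i` for `n`, `R_i` for `r`). -/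
def tailProd (m : Fin d → ℕ) (i : ℕ) : ℕ := ∏ j : Fin d with d - i ≤ j.val, m j

/-- The threshold `N_i R_i / (n_{d-i} r_{d-i}) ^ i` for `1 ≤ i ≤ d - 1` (`Fin.rev i` is the mode
`d - i` when modes are numbered from one). -/
noncomputable def threshold (i : Fin d) : ℝ :=
  ((tailProd n i : ℝ) * tailProd r i) / ((n i.rev : ℝ) * r i.rev) ^ (i : ℕ)

/-- The case of the matrix term: the first `i` in `1, …, d` such that `i = d` or
`P < threshold i`. -/
noncomputable def caseIndex : ℕ :=
  sInf {i : ℕ | 1 ≤ i ∧ ∀ h : i < d, (P : ℝ) < threshold n r ⟨i, h⟩}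

/-- The case index `i` is characterized by `1 ≤ i ≤ d`, `threshold (i - 1) ≤ P` (if `2 ≤ i`), and
`P < threshold i` (if `i < d`). -/
theorem caseIndex_spec (hd : 1 ≤ d) :
    (1 ≤ caseIndex n r P ∧ caseIndex n r P ≤ d) ∧
    (∀ h : caseIndex n r P - 1 < d, 2 ≤ caseIndex n r P →
      threshold n r ⟨caseIndex n r P - 1, h⟩ ≤ P) ∧
    (∀ h : caseIndex n r P < d, (P : ℝ) < threshold n r ⟨caseIndex n r P, h⟩) := by
  have hmem : d ∈ {i : ℕ | 1 ≤ i ∧ ∀ h : i < d, (P : ℝ) < threshold n r ⟨i, h⟩} :=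
    ⟨hd, fun h => absurd h (lt_irrefl d)⟩
  have hs := Nat.sInf_mem ⟨d, hmem⟩
  refine ⟨⟨hs.1, Nat.sInf_le hmem⟩, fun h h2 => ?_, hs.2⟩
  by_contra hlt
  have h3 : caseIndex n r P ≤ caseIndex n r P - 1 :=
    Nat.sInf_le ⟨by omega, fun _ => not_le.mp hlt⟩
  omega

/-- The matrix term `A`. -/
noncomputable def matrixTerm : ℝ :=
  (∑ j : Fin d with j.val < d - caseIndex n r P, (n j : ℝ) * r j) +
    caseIndex n r P *
      (((tailProd n (caseIndex n r P) : ℝ) * tailProd r (caseIndex n r P)) / P) ^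
        (1 / (caseIndex n r P : ℝ))

/-- The tensor term `B`. -/
noncomputable def tensorTerm : ℝ :=
  if (P : ℝ) < (∏ k, (n k : ℝ)) / ∏ k, (r k : ℝ) then
    ∏ k, (r k : ℝ) + (∏ k, (n k : ℝ)) / P
  else 2 * (((∏ k, (n k : ℝ)) * ∏ k, (r k : ℝ)) / P) ^ (1 / 2 : ℝ)

/-- The average amount `O` of data owned by a processor. -/
noncomputable def owned : ℝ :=
  (∏ k, (n k : ℝ) + ∏ k, (r k : ℝ) + ∑ k, (n k : ℝ) * r k) / P

/-- The lower bound `A + B - O`. -/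
noncomputable def lowerBound : ℝ := matrixTerm n r P + tensorTerm n r P - owned n r P

end LowerBound

/-! ### The algorithm on a `2d`-dimensional processor grid -/

/-- Bandwidth cost of a bandwidth-optimal All-Gather or Reduce-Scatter on `Q` processors, where `w`
is the number of words on each processor after the All-Gather or before the Reduce-Scatter. -/
noncomputable def collectiveCost (Q w : ℝ) : ℝ := (1 - 1 / Q) * w

/-- The `c`-th of `b` consecutive blocks of equal length of the indices `0, …, m - 1`. -/
def block (m b : ℕ) (c : Fin b) : Finset (Fin m) :=
  Finset.univ.filter fun i => c.val * (m / b) ≤ i.val ∧ i.val < (c.val + 1) * (m / b)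

/-- A processor `(p'_1, …, p'_d, q'_1, …, q'_d)` of the grid. -/
abbrev GridProc {d : ℕ} (p q : Fin d → ℕ) : Type := Idx p × Idx q

section Grid

variable {d : ℕ} (n r : Fin d → ℕ) {p q : Fin d → ℕ}

/-- Indices of the subtensor of the input that processor `s` gathers. -/
def blockX (s : GridProc p q) : Finset (Idx n) :=
  Fintype.piFinset fun k => block (n k) (p k) (s.1 k)

/-- Indices of the submatrix of the `k`-th matrix that processor `s` gathers. -/
def blockA (k : Fin d) (s : GridProc p q) : Finset (Fin (n k) × Fin (r k)) :=
  block (n k) (p k) (s.1 k) ×ˢ block (r k) (q k) (s.2 k)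

/-- Indices of the subtensor of the output to which processor `s` contributes. -/
def blockY (s : GridProc p q) : Finset (Idx r) :=
  Fintype.piFinset fun k => block (r k) (q k) (s.2 k)

/-- The processors `(p'_1, …, p'_d, *, …, *)`. -/
def groupX (s : GridProc p q) : Finset (GridProc p q) :=
  Finset.univ.filter fun t => t.1 = s.1

/-- The processors `(*, …, *, p'_k, *, …, *, q'_k, *, …, *)`. -/
def groupA (k : Fin d) (s : GridProc p q) : Finset (GridProc p q) :=
  Finset.univ.filter fun t => t.1 k = s.1 k ∧ t.2 k = s.2 k

/-- The processors `(*, …, *, q'_1, …, q'_d)`. -/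
def groupY (s : GridProc p q) : Finset (GridProc p q) :=
  Finset.univ.filter fun t => t.2 = s.2

/-- Bandwidth cost of a line of the algorithm, in which each processor `s` takes part in one
collective, over the processors `group s`, with `words s` words. -/
noncomputable def lineCost (group : GridProc p q → Finset (GridProc p q))
    (words : GridProc p q → ℕ) : ℝ :=
  ⨆ s, collectiveCost (group s).card (words s)

variable (p q) in
/-- Bandwidth cost of the algorithm: All-Gather of the input tensor, All-Gather of each matrix, and
Reduce-Scatter of the output tensor. -/
noncomputable def gridAlgorithmCost : ℝ :=
  lineCost (p := p) (q := q) groupX (fun s => (blockX n s).card) +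
    ∑ k, lineCost (p := p) (q := q) (groupA k) (fun s => (blockA n r k s).card) +
    lineCost (p := p) (q := q) groupY (fun s => (blockY r s).card)

variable {n r}

/-- The temporary tensor that processor `s` computes from the gathered data; the algorithm uses its
entries at `j ∈ blockY r s` only. -/
noncomputable def localMultiTTM (X : Idx n → ℝ)
    (A : ∀ k : Fin d, Matrix (Fin (n k)) (Fin (r k)) ℝ) (s : GridProc p q) (j : Idx r) : ℝ :=
  ∑ i ∈ blockX n s, X i * ∏ k, A k (i k) (j k)

/-- The result of the Reduce-Scatter over the group of processor `s`, at `j ∈ blockY r s`. -/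
noncomputable def gridAlgorithmOutput (X : Idx n → ℝ)
    (A : ∀ k : Fin d, Matrix (Fin (n k)) (Fin (r k)) ℝ) (s : GridProc p q) (j : Idx r) : ℝ :=
  ∑ t ∈ groupY s, localMultiTTM X A t j

end Grid

/-- The cost of the algorithm as a function of real grid dimensions: the sum of the costs of its
collectives, over `P / p`, `P / (p_k q_k)` and `P / q` processors. -/
noncomputable def gridCost {d : ℕ} (n r : Fin d → ℕ) (P : ℕ) (p q : Fin d → ℝ) : ℝ :=
  collectiveCost (P / ∏ k, p k) ((∏ k, (n k : ℝ)) / ∏ k, p k) +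
    ∑ k, collectiveCost (P / (p k * q k)) ((n k : ℝ) * r k / (p k * q k)) +
    collectiveCost (P / ∏ k, q k) ((∏ k, (r k : ℝ)) / ∏ k, q k)

end MultiTTM

namespace MultiTTM

/-!
The processor that owns the fewest entries must communicate every other entry that occurs in its
terms. Atomicity relates the number of its terms to the numbers of entries that occur in them: the
product of the numbers `a k` of matrix entries, and the product of the numbers `x` and `y` of input
and output tensor entries, are both at least `n r / P`. The sum of positive `a k ≤ m k` with a given
lower bound on their product is minimized by truncation, `a k = min (m k) t`; the optimal values are
`A` and `B`.

Conversely, let `c` and `(x, y)` be these optima. With `u k = n k / p k` and `v k = r k / q k`, a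
real grid has cost `∏ u k + ∏ v k + ∑ u k * v k - O`. If the `c k` factor as `u k * v k` with
`∏ u k = x` and `∏ v k = y`, the cost is `LB`. Otherwise the intermediate value theorem still gives
`u` and `v` with these products and `∑ u k * v k ≤ ∑ c k + (y - 1)`, and the excess is at most
`2 LB` because `y (1 - 1 / P) ≤ LB`.
-/

section Inequalities

variable {ι : Type*}

theorem one_add_sum_le_prod_one_add {K : Type*} [CommSemiring K] [PartialOrder K] [IsOrderedRing K]
    (s : Finset ι) {f : ι → K} (hf : ∀ i ∈ s, 0 ≤ f i) :
    1 + ∑ i ∈ s, f i ≤ ∏ i ∈ s, (1 + f i) := by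
  induction s using Finset.cons_induction with
  | empty => simp
  | cons a s ha ih =>
    rw [Finset.forall_mem_cons] at hf
    rw [Finset.sum_cons, Finset.prod_cons]
    calc 1 + (f a + ∑ i ∈ s, f i) ≤ 1 + (f a + ∑ i ∈ s, f i) + f a * ∑ i ∈ s, f i :=
          le_add_of_nonneg_right (mul_nonneg hf.1 (Finset.sum_nonneg hf.2))
      _ = (1 + f a) * (1 + ∑ i ∈ s, f i) := by ring
      _ ≤ (1 + f a) * ∏ i ∈ s, (1 + f i) :=
          mul_le_mul_of_nonneg_left (ih hf.2) (add_nonneg zero_le_one hf.1)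

variable [Fintype ι] {m a N R c : ι → ℝ} {s t x y : ℝ}

theorem exists_mem_Icc_prod_eq {lo hi : ι → ℝ} (h : lo ≤ hi) (hlo : ∏ k, lo k ≤ y)
    (hhi : y ≤ ∏ k, hi k) : ∃ v ∈ Set.Icc lo hi, ∏ k, v k = y :=
  (convex_Icc lo hi).isPreconnected.intermediate_value (f := fun v => ∏ k, v k)
    (Set.left_mem_Icc.2 h) (Set.right_mem_Icc.2 h) (by fun_prop) ⟨hlo, hhi⟩

-- The tangent line of `log` at `min m t`, with slope `1 / t` instead of `1 / min m t`.
theorem min_add_mul_log_div_le {m a : ℝ} (ht : 0 < t) (ha : 0 < a) (ham : a ≤ m) :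
    min m t + t * Real.log (a / min m t) ≤ a := by
  have tangent {b : ℝ} (hb : 0 < b) : b * Real.log (a / b) ≤ a - b := by
    have := mul_le_mul_of_nonneg_left (Real.log_le_sub_one_of_pos (div_pos ha hb)) hb.le
    rwa [mul_sub, mul_div_cancel₀ _ hb.ne', mul_one] at this
  rcases le_total m t with hmt | htm
  · have hm : 0 < m := ha.trans_le ham
    have hlog : Real.log (a / m) ≤ 0 :=
      Real.log_nonpos (div_pos ha hm).le ((div_le_one hm).2 ham)
    rw [min_eq_left hmt]
    linarith [tangent hm, mul_le_mul_of_nonpos_right hmt hlog]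
  · rw [min_eq_right htm]
    linarith [tangent ht]

theorem sum_min_le_sum_of_prod_min_le_prod (ht : 0 < t) (ha : ∀ k, 0 < a k) (ham : a ≤ m)
    (hprod : ∏ k, min (m k) t ≤ ∏ k, a k) : ∑ k, min (m k) t ≤ ∑ k, a k := by
  have hmin (k : ι) : 0 < min (m k) t := lt_min ((ha k).trans_le (ham k)) ht
  have hlog : 0 ≤ ∑ k, Real.log (a k / min (m k) t) := by
    rw [← Real.log_prod fun k _ => (div_pos (ha k) (hmin k)).ne', Finset.prod_div_distrib]
    exact Real.log_nonneg ((one_le_div (Finset.prod_pos fun k _ => hmin k)).2 hprod)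
  calc ∑ k, min (m k) t ≤ ∑ k, min (m k) t + t * ∑ k, Real.log (a k / min (m k) t) :=
        le_add_of_nonneg_right (mul_nonneg ht.le hlog)
    _ = ∑ k, (min (m k) t + t * Real.log (a k / min (m k) t)) := by
        rw [Finset.mul_sum, Finset.sum_add_distrib]
    _ ≤ ∑ k, a k := Finset.sum_le_sum fun k _ => min_add_mul_log_div_le ht (ha k) (ham k)

theorem one_le_of_one_le_prod_min [Nonempty ι] (hm : ∀ k, 0 ≤ m k) (ht : 0 ≤ t)
    (h : 1 ≤ ∏ k, min (m k) t) : 1 ≤ t := by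
  by_contra! hlt
  have hpow : ∏ k, min (m k) t ≤ t ^ Fintype.card ι :=
    (Finset.prod_le_prod (fun k _ => le_min (hm k) ht) fun k _ => min_le_right _ _).trans_eq
      (by simp)
  exact (h.trans hpow).not_gt (pow_lt_one₀ ht hlt Fintype.card_ne_zero)

theorem sum_div_le_sum_of_prod_div_le_prod (hs : 0 < s) (ha : ∀ k, 0 < a k) (ham : a ≤ m)
    (hprod : (∏ k, m k) / s ≤ ∏ k, a k) : (∑ k, m k) / s ≤ ∑ k, a k := by
  classical
  rw [Finset.sum_div]
  refine Finset.sum_le_sum fun k _ => ?_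
  set others := ∏ j ∈ Finset.univ.erase k, a j
  have hothers : 0 < others := Finset.prod_pos fun j _ => ha j
  refine le_of_mul_le_mul_right ?_ hothers
  calc m k / s * others ≤ m k / s * ∏ j ∈ Finset.univ.erase k, m j :=
        mul_le_mul_of_nonneg_left (Finset.prod_le_prod (fun j _ => (ha j).le) fun j _ => ham j)
          (div_nonneg ((ha k).le.trans (ham k)) hs.le)
    _ = (∏ j, m j) / s := by
        rw [div_mul_eq_mul_div, Finset.mul_prod_erase _ _ (Finset.mem_univ k)]
    _ ≤ ∏ j, a j := hprod
    _ = a k * others := (Finset.mul_prod_erase _ _ (Finset.mem_univ k)).symm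

theorem div_min_le_min {N R c : ℝ} (hN : 1 ≤ N) (hR : 1 ≤ R) (hc : 1 ≤ c) (hcm : c ≤ N * R) :
    c / min R c ≤ min N c := by
  rcases le_total R c with h | h
  · rw [min_eq_left h]
    exact le_min ((div_le_iff₀ (by linarith)).2 hcm) (div_le_self (by linarith) hR)
  · rw [min_eq_right h, div_self (by linarith)]
    exact le_min hN hc

theorem exists_mul_eq_of_le_prod_min (hN : 1 ≤ N) (hR : 1 ≤ R) (hc : c ∈ Set.Icc 1 (N * R))
    (hprod : ∏ k, c k = x * y) (hx : 0 < x) (hxc : x ≤ ∏ k, min (N k) (c k))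
    (hyc : y ≤ ∏ k, min (R k) (c k)) :
    ∃ u ∈ Set.Icc 1 N, ∃ v ∈ Set.Icc 1 R, ∏ k, u k = x ∧ ∏ k, v k = y ∧ u * v = c := by
  have hmin (k : ι) : 0 < min (R k) (c k) :=
    zero_lt_one.trans_le (le_min (hR k) (hc.1 k))
  have hlo : ∏ k, c k / min (R k) (c k) ≤ x := by
    rw [Finset.prod_div_distrib, div_le_iff₀ (Finset.prod_pos fun k _ => hmin k), hprod]
    exact mul_le_mul_of_nonneg_left hyc hx.le
  obtain ⟨u, hu, hux⟩ := exists_mem_Icc_prod_eq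
    (fun k => div_min_le_min (hN k) (hR k) (hc.1 k) (hc.2 k)) hlo hxc
  have hu1 (k : ι) : 1 ≤ u k := ((one_le_div (hmin k)).2 (min_le_right _ _)).trans (hu.1 k)
  have hu0 (k : ι) : 0 < u k := zero_lt_one.trans_le (hu1 k)
  refine ⟨u, ⟨hu1, fun k => (hu.2 k).trans (min_le_left _ _)⟩, c / u, ⟨fun k => ?_, fun k => ?_⟩,
    hux, ?_, funext fun k => mul_div_cancel₀ _ (hu0 k).ne'⟩
  · exact (one_le_div (hu0 k)).2 ((hu.2 k).trans (min_le_right _ _))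
  · calc c k / u k ≤ min (R k) (c k) := (div_le_comm₀ (hmin k) (hu0 k)).1 (hu.1 k)
      _ ≤ R k := min_le_left _ _
  · simp only [Pi.div_apply, Finset.prod_div_distrib, hux, hprod, mul_div_cancel_left₀ _ hx.ne']

theorem mul_le_add_sub_one {R c u v : ℝ} (hR : 1 ≤ R) (hc : 1 ≤ c)
    (hu : u ∈ Set.Icc 1 (c / min R c)) (hv : v ∈ Set.Icc (min R c) R) :
    u * v ≤ c + (v - 1) := by
  rcases le_total R c with h | h
  · rw [min_eq_left h] at hu hv
    have hvR : v = R := le_antisymm hv.2 hv.1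
    rw [hvR]
    linarith [(le_div_iff₀ (by linarith)).1 hu.2]
  · rw [min_eq_right h, div_self (by linarith), Set.Icc_self] at hu
    rw [Set.eq_of_mem_singleton hu]
    linarith

-- The modes with `R k ≤ c k` have no excess; the others have `u k = 1`, hence excess `v k - c k`.
theorem exists_sum_mul_le_of_prod_min_le (hN : 1 ≤ N) (hR : 1 ≤ R) (hc : c ∈ Set.Icc 1 (N * R))
    (hprod : ∏ k, c k = x * y) (hx : 1 ≤ x) (hcy : ∏ k, min (R k) (c k) ≤ y)
    (hyR : y ≤ ∏ k, R k) :
    ∃ u ∈ Set.Icc 1 N, ∃ v ∈ Set.Icc 1 R, ∏ k, u k = x ∧ ∏ k, v k = y ∧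
      ∑ k, u k * v k ≤ ∑ k, c k + (y - 1) := by
  have hmin1 (k : ι) : 1 ≤ min (R k) (c k) := le_min (hR k) (hc.1 k)
  have hmin (k : ι) : 0 < min (R k) (c k) := zero_lt_one.trans_le (hmin1 k)
  have hhi : x ≤ ∏ k, c k / min (R k) (c k) := by
    rw [Finset.prod_div_distrib, le_div_iff₀ (Finset.prod_pos fun k _ => hmin k), hprod]
    exact mul_le_mul_of_nonneg_left hcy (zero_le_one.trans hx)
  obtain ⟨v, hv, hvy⟩ := exists_mem_Icc_prod_eq (fun k => min_le_left (R k) (c k)) hcy hyR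
  obtain ⟨u, hu, hux⟩ := exists_mem_Icc_prod_eq (lo := 1)
    (fun k => (one_le_div (hmin k)).2 (min_le_right _ _)) (by simpa using hx) hhi
  have hv1 : 1 ≤ v := fun k => (hmin1 k).trans (hv.1 k)
  refine ⟨u, ⟨hu.1, fun k => (hu.2 k).trans ?_⟩, v, ⟨hv1, hv.2⟩, hux, hvy, ?_⟩
  · exact (div_min_le_min (hN k) (hR k) (hc.1 k) (hc.2 k)).trans (min_le_left _ _)
  · calc ∑ k, u k * v k ≤ ∑ k, (c k + (v k - 1)) := Finset.sum_le_sum fun k _ =>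
          mul_le_add_sub_one (hR k) (hc.1 k) ⟨hu.1 k, hu.2 k⟩ ⟨hv.1 k, hv.2 k⟩
      _ = ∑ k, c k + ∑ k, (v k - 1) := Finset.sum_add_distrib
      _ ≤ ∑ k, c k + (y - 1) := by
        have := one_add_sum_le_prod_one_add Finset.univ fun k _ => sub_nonneg.2 (hv1 k)
        simp only [Pi.one_apply, add_sub_cancel, hvy] at this
        linarith

theorem exists_sum_mul_le (hN : 1 ≤ N) (hR : 1 ≤ R) (hc : c ∈ Set.Icc 1 (N * R))
    (hprod : ∏ k, c k = x * y) (hx : x ∈ Set.Icc 1 (∏ k, N k)) (hy : y ∈ Set.Icc 1 (∏ k, R k))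
    (hxy : x ≤ y ∨ ∏ k, min (R k) (c k) ≤ y) :
    ∃ u ∈ Set.Icc 1 N, ∃ v ∈ Set.Icc 1 R, ∏ k, u k = x ∧ ∏ k, v k = y ∧
      ∑ k, u k * v k ≤ ∑ k, c k + (y - 1) := by
  by_cases hcy : ∏ k, min (R k) (c k) ≤ y
  · exact exists_sum_mul_le_of_prod_min_le hN hR hc hprod hx.1 hcy hy.2
  by_cases hcx : ∏ k, min (N k) (c k) ≤ x
  · obtain ⟨v, hv, u, hu, hvy, hux, hsum⟩ := exists_sum_mul_le_of_prod_min_le hR hN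
      (by rwa [mul_comm]) (hprod.trans (mul_comm _ _)) hy.1 hcx hx.2
    refine ⟨u, hu, v, hv, hux, hvy, ?_⟩
    simp only [mul_comm (u _)]
    linarith [hxy.resolve_right hcy]
  · obtain ⟨u, hu, v, hv, hux, hvy, rfl⟩ := exists_mul_eq_of_le_prod_min hN hR hc hprod
      (zero_lt_one.trans_le hx.1) (not_le.1 hcx).le (not_le.1 hcy).le
    exact ⟨u, hu, v, hv, hux, hvy, le_add_of_nonneg_right (sub_nonneg.2 hy.1)⟩

end Inequalities

/-! ### The matrix and tensor terms as minima -/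

section Optima

variable {d : ℕ} {n r : Fin d → ℕ} {P : ℕ}

theorem tailProd_zero (m : Fin d → ℕ) : tailProd m 0 = 1 :=
  Finset.prod_eq_one fun j hj => absurd (Finset.mem_filter.1 hj).2 (by omega)

theorem tailProd_add_one (m : Fin d → ℕ) (i : Fin d) :
    tailProd m (i + 1) = m i.rev * tailProd m i := by
  have hinsert : (Finset.univ.filter fun j : Fin d => d - (i + 1) ≤ j.val) =
      insert i.rev (Finset.univ.filter fun j : Fin d => d - i ≤ j.val) := by
    ext j
    simp only [Finset.mem_filter, Finset.mem_univ, true_and, Finset.mem_insert, Fin.ext_iff,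
      Fin.val_rev]
    omega
  rw [tailProd, hinsert, Finset.prod_insert (by simp; omega), tailProd]

theorem tailProd_mul_tailProd (n r : Fin d → ℕ) (i : ℕ) :
    (tailProd n i : ℝ) * tailProd r i = ∏ j : Fin d with d - i ≤ j.val, (n j : ℝ) * r j := by
  simp only [tailProd, Nat.cast_prod, Finset.prod_mul_distrib]

theorem card_filter_sub_le_val {i : ℕ} (hi : i ≤ d) :
    (Finset.univ.filter fun j : Fin d => d - i ≤ j.val).card = i := by
  simp only [← not_lt]
  rw [Finset.filter_not, Finset.card_sdiff_of_subset (Finset.filter_subset _ _),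
    Fin.card_filter_val_lt, Finset.card_univ, Fintype.card_fin]
  omega

theorem pow_le_of_lt_threshold (hn : ∀ k, 0 < n k) (hr : ∀ k, 0 < r k) (hP : 0 < P) {i : Fin d}
    (h : (P : ℝ) < threshold n r i) :
    ((n i.rev : ℝ) * r i.rev) ^ (i : ℕ) ≤ (tailProd n i : ℝ) * tailProd r i / P := by
  have := hn i.rev
  have := hr i.rev
  rw [threshold, lt_div_iff₀ (by positivity)] at h
  rw [le_div_iff₀ (by positivity)]
  linarith

theorem le_pow_of_threshold_le (hn : ∀ k, 0 < n k) (hr : ∀ k, 0 < r k) (hP : 0 < P) {i : Fin d}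
    (h : threshold n r i ≤ P) :
    (tailProd n (i + 1) : ℝ) * tailProd r (i + 1) / P ≤
      ((n i.rev : ℝ) * r i.rev) ^ (i + 1 : ℕ) := by
  have := hn i.rev
  have := hr i.rev
  rw [threshold, div_le_iff₀ (by positivity)] at h
  rw [div_le_iff₀ (by positivity), tailProd_add_one, tailProd_add_one, pow_succ]
  push_cast
  calc (n i.rev * tailProd n i * (r i.rev * tailProd r i) : ℝ)
      = tailProd n i * tailProd r i * (n i.rev * r i.rev) := by ring
    _ ≤ P * (n i.rev * r i.rev) ^ (i : ℕ) * (n i.rev * r i.rev) := by gcongr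
    _ = (n i.rev * r i.rev) ^ (i : ℕ) * (n i.rev * r i.rev) * P := by ring

variable (n r P) in
/-- The common value of the truncated sizes in the matrix term: `matrixTerm` is the sum of the
numbers `min (n k * r k) matrixCutoff`. -/
noncomputable def matrixCutoff : ℝ :=
  ((tailProd n (caseIndex n r P) : ℝ) * tailProd r (caseIndex n r P) / P) ^
    (1 / (caseIndex n r P : ℝ))

theorem matrixCutoff_nonneg : 0 ≤ matrixCutoff n r P := by
  unfold matrixCutoff
  positivity

theorem matrixCutoff_pow (hd : 1 ≤ d) :
    matrixCutoff n r P ^ caseIndex n r P =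
      (tailProd n (caseIndex n r P) : ℝ) * tailProd r (caseIndex n r P) / P := by
  rw [matrixCutoff, one_div, Real.rpow_inv_natCast_pow (by positivity)
    (Nat.one_le_iff_ne_zero.1 (caseIndex_spec n r P hd).1.1)]

theorem mul_le_matrixCutoff (hd : 1 ≤ d) (hn : ∀ k, 0 < n k) (hr : ∀ k, 0 < r k)
    (hmono : Monotone fun k => n k * r k) (hP : 0 < P) {k : Fin d}
    (hk : k.val < d - caseIndex n r P) : (n k : ℝ) * r k ≤ matrixCutoff n r P := by
  obtain ⟨⟨hI, -⟩, -, hlt⟩ := caseIndex_spec n r P hd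
  let i : Fin d := ⟨caseIndex n r P, by omega⟩
  have hki : k ≤ i.rev := Fin.le_def.2 (by rw [Fin.val_rev]; simp only [i]; omega)
  calc (n k : ℝ) * r k ≤ n i.rev * r i.rev := by exact_mod_cast hmono hki
    _ ≤ matrixCutoff n r P := by
      refine le_of_pow_le_pow_left₀ (Nat.one_le_iff_ne_zero.1 hI) matrixCutoff_nonneg ?_
      rw [matrixCutoff_pow hd]
      exact pow_le_of_lt_threshold hn hr hP (hlt i.isLt)

theorem matrixCutoff_le_mul (hd : 1 ≤ d) (hn : ∀ k, 0 < n k) (hr : ∀ k, 0 < r k)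
    (hmono : Monotone fun k => n k * r k) (hP : 0 < P) {k : Fin d}
    (hk : d - caseIndex n r P ≤ k.val) : matrixCutoff n r P ≤ (n k : ℝ) * r k := by
  obtain ⟨⟨hI, hId⟩, hle, -⟩ := caseIndex_spec n r P hd
  let i : Fin d := ⟨caseIndex n r P - 1, by omega⟩
  have hi : i.val + 1 = caseIndex n r P := Nat.sub_add_cancel hI
  have hthreshold : threshold n r i ≤ P := by
    rcases hI.eq_or_lt with h | h
    · have hi0 : (i : ℕ) = 0 := by omega
      simpa [threshold, hi0, tailProd_zero] using Nat.succ_le_of_lt hP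
    · exact hle i.isLt h
  have hik : i.rev ≤ k := Fin.le_def.2 (by rw [Fin.val_rev]; omega)
  calc matrixCutoff n r P ≤ n i.rev * r i.rev := by
        refine le_of_pow_le_pow_left₀ (Nat.one_le_iff_ne_zero.1 hI) (by positivity) ?_
        rw [matrixCutoff_pow hd, ← hi]
        exact le_pow_of_threshold_le hn hr hP hthreshold
    _ ≤ (n k : ℝ) * r k := by exact_mod_cast hmono hik

theorem min_mul_matrixCutoff (hd : 1 ≤ d) (hn : ∀ k, 0 < n k) (hr : ∀ k, 0 < r k)
    (hmono : Monotone fun k => n k * r k) (hP : 0 < P) (k : Fin d) :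
    min ((n k : ℝ) * r k) (matrixCutoff n r P) =
      if k.val < d - caseIndex n r P then (n k : ℝ) * r k else matrixCutoff n r P := by
  split_ifs with hk
  · exact min_eq_left (mul_le_matrixCutoff hd hn hr hmono hP hk)
  · exact min_eq_right (matrixCutoff_le_mul hd hn hr hmono hP (not_lt.1 hk))

theorem matrixTerm_eq_sum_min (hd : 1 ≤ d) (hn : ∀ k, 0 < n k) (hr : ∀ k, 0 < r k)
    (hmono : Monotone fun k => n k * r k) (hP : 0 < P) :
    matrixTerm n r P = ∑ k, min ((n k : ℝ) * r k) (matrixCutoff n r P) := by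
  simp only [min_mul_matrixCutoff hd hn hr hmono hP, Finset.sum_ite, Finset.sum_const, not_lt,
    card_filter_sub_le_val (caseIndex_spec n r P hd).1.2, nsmul_eq_mul]
  rfl

theorem prod_min_matrixCutoff (hd : 1 ≤ d) (hn : ∀ k, 0 < n k) (hr : ∀ k, 0 < r k)
    (hmono : Monotone fun k => n k * r k) (hP : 0 < P) :
    ∏ k, min ((n k : ℝ) * r k) (matrixCutoff n r P) = (∏ k, (n k : ℝ) * r k) / P := by
  simp only [min_mul_matrixCutoff hd hn hr hmono hP, Finset.prod_ite, Finset.prod_const, not_lt,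
    card_filter_sub_le_val (caseIndex_spec n r P hd).1.2, matrixCutoff_pow hd,
    tailProd_mul_tailProd]
  rw [← mul_div_assoc]
  simp only [← not_lt]
  rw [Finset.prod_filter_mul_prod_filter_not]

theorem matrixCutoff_pos (hd : 1 ≤ d) (hn : ∀ k, 0 < n k) (hr : ∀ k, 0 < r k) (hP : 0 < P) :
    0 < matrixCutoff n r P := by
  have hpos : 0 < matrixCutoff n r P ^ caseIndex n r P := by
    have (k : Fin d) : (0 : ℝ) < n k * r k := by exact_mod_cast Nat.mul_pos (hn k) (hr k)
    rw [matrixCutoff_pow hd, tailProd_mul_tailProd]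
    exact div_pos (Finset.prod_pos fun k _ => this k) (Nat.cast_pos.2 hP)
  exact matrixCutoff_nonneg.lt_of_ne' fun h => hpos.ne' <| by
    rw [h, zero_pow (Nat.one_le_iff_ne_zero.1 (caseIndex_spec n r P hd).1.1)]

theorem matrixTerm_le_sum (hd : 1 ≤ d) (hn : ∀ k, 0 < n k) (hr : ∀ k, 0 < r k)
    (hmono : Monotone fun k => n k * r k) (hP : 0 < P) {a : Fin d → ℝ} (ha : ∀ k, 0 < a k)
    (ham : ∀ k, a k ≤ (n k : ℝ) * r k) (hprod : (∏ k, (n k : ℝ) * r k) / P ≤ ∏ k, a k) :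
    matrixTerm n r P ≤ ∑ k, a k := by
  rw [matrixTerm_eq_sum_min hd hn hr hmono hP]
  exact sum_min_le_sum_of_prod_min_le_prod (matrixCutoff_pos hd hn hr hP) ha ham
    ((prod_min_matrixCutoff hd hn hr hmono hP).trans_le hprod)

theorem tensorTerm_le_add (hP : 0 < P) {x y : ℝ} (hx : 0 ≤ x)
    (hy : y ∈ Set.Ioc 0 (∏ k, (r k : ℝ)))
    (hxy : (∏ k, (n k : ℝ)) * (∏ k, (r k : ℝ)) / P ≤ x * y) :
    tensorTerm n r P ≤ x + y := by
  obtain ⟨hy0, hyR⟩ := hy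
  unfold tensorTerm
  generalize ∏ k, (r k : ℝ) = R at *
  generalize ∏ k, (n k : ℝ) = N at *
  split_ifs with h
  · have hRN : R ≤ N / P := ((lt_div_comm₀ (Nat.cast_pos.2 hP) (hy0.trans_le hyR)).1 h).le
    refine le_of_mul_le_mul_right ?_ hy0
    calc (R + N / P) * y = N * R / P + y * y - (R - y) * (N / P - y) := by ring
      _ ≤ x * y + y * y - 0 := by
        gcongr
        exact mul_nonneg (sub_nonneg.2 hyR) (sub_nonneg.2 (hyR.trans hRN))
      _ = (x + y) * y := by ring
  · have hsqrt : √(N * R / P) ≤ (x + y) / 2 := Real.sqrt_le_iff.2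
      ⟨by linarith, hxy.trans (by linarith [sq_nonneg (x - y)])⟩
    rw [← Real.sqrt_eq_rpow]
    linarith

theorem exists_tensorTerm_eq_add (hr : ∀ k, 0 < r k) (hnr : ∏ k, r k ≤ ∏ k, n k) (hP : 0 < P)
    (hPnr : P ≤ (∏ k, n k) * ∏ k, r k) :
    ∃ x ∈ Set.Icc 1 (∏ k, (n k : ℝ)), ∃ y ∈ Set.Icc 1 (∏ k, (r k : ℝ)),
      tensorTerm n r P = x + y ∧ x * y = (∏ k, (n k : ℝ)) * (∏ k, (r k : ℝ)) / P ∧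
        (x ≤ y ∨ y = ∏ k, (r k : ℝ)) := by
  have hR : 1 ≤ ∏ k, (r k : ℝ) := by
    exact_mod_cast Nat.one_le_iff_ne_zero.2 (Finset.prod_pos fun k _ => hr k).ne'
  have hRN : ∏ k, (r k : ℝ) ≤ ∏ k, (n k : ℝ) := by exact_mod_cast hnr
  have hP1 : (1 : ℝ) ≤ P := Nat.one_le_cast.2 hP
  have hPNR : (P : ℝ) ≤ (∏ k, (n k : ℝ)) * ∏ k, (r k : ℝ) := by exact_mod_cast hPnr
  unfold tensorTerm
  generalize ∏ k, (r k : ℝ) = R at *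
  generalize ∏ k, (n k : ℝ) = N at *
  have hP0 : (0 : ℝ) < P := zero_lt_one.trans_le hP1
  have hR0 : 0 < R := zero_lt_one.trans_le hR
  split_ifs with h
  · have hRNP : R ≤ N / P := ((lt_div_comm₀ hP0 hR0).1 h).le
    exact ⟨N / P, ⟨hR.trans hRNP, div_le_self (hR0.le.trans hRN) hP1⟩, R, ⟨hR, le_rfl⟩,
      add_comm _ _, div_mul_eq_mul_div _ _ _, Or.inr rfl⟩
  · have hNPR : N / P ≤ R := (div_le_comm₀ hR0 hP0).1 (not_lt.1 h)
    have hle : √(N * R / P) ≤ R := Real.sqrt_le_iff.2 ⟨hR0.le, by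
      rw [mul_div_right_comm, sq]
      exact mul_le_mul_of_nonneg_right hNPR hR0.le⟩
    have hNRP : 1 ≤ N * R / P := (one_le_div hP0).2 hPNR
    have hge : 1 ≤ √(N * R / P) := Real.one_le_sqrt.2 hNRP
    refine ⟨√(N * R / P), ⟨hge, hle.trans hRN⟩, √(N * R / P), ⟨hge, hle⟩, ?_,
      Real.mul_self_sqrt (zero_le_one.trans hNRP), Or.inl le_rfl⟩
    rw [← Real.sqrt_eq_rpow, two_mul]

end Optima

/-! ### A near-optimal grid -/

section GridCost

variable {d : ℕ} {n r : Fin d → ℕ} {P : ℕ}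

theorem collectiveCost_div_div {K s : ℝ} (hK : K ≠ 0) (hs : s ≠ 0) (w : ℝ) :
    collectiveCost (K / s) (w / s) = w / s - w / K := by
  unfold collectiveCost
  field_simp

theorem gridCost_eq {p q : Fin d → ℝ} (hp : ∀ k, p k ≠ 0) (hq : ∀ k, q k ≠ 0) (hP : 0 < P) :
    gridCost n r P p q =
      (∏ k, (n k : ℝ)) / ∏ k, p k + (∏ k, (r k : ℝ)) / ∏ k, q k +
        ∑ k, (n k : ℝ) * r k / (p k * q k) - owned n r P := by
  have hP0 : (P : ℝ) ≠ 0 := (Nat.cast_pos.2 hP).ne'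
  rw [gridCost, collectiveCost_div_div hP0 (Finset.prod_ne_zero_iff.2 fun k _ => hp k),
    collectiveCost_div_div hP0 (Finset.prod_ne_zero_iff.2 fun k _ => hq k)]
  simp only [collectiveCost_div_div hP0 (mul_ne_zero (hp _) (hq _)), Finset.sum_sub_distrib,
    ← Finset.sum_div, owned]
  ring

theorem gridCost_div {u v : Fin d → ℝ} (hn : ∀ k, 0 < n k) (hr : ∀ k, 0 < r k)
    (hu : ∀ k, u k ≠ 0) (hv : ∀ k, v k ≠ 0) (hP : 0 < P) :
    gridCost n r P (fun k => n k / u k) (fun k => r k / v k) =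
      ∏ k, u k + ∏ k, v k + ∑ k, u k * v k - owned n r P := by
  have hn0 (k : Fin d) : (n k : ℝ) ≠ 0 := (Nat.cast_pos.2 (hn k)).ne'
  have hr0 (k : Fin d) : (r k : ℝ) ≠ 0 := (Nat.cast_pos.2 (hr k)).ne'
  rw [gridCost_eq (fun k => div_ne_zero (hn0 k) (hu k)) (fun k => div_ne_zero (hr0 k) (hv k)) hP]
  simp only [← Finset.prod_div_distrib, div_mul_div_comm]
  simp only [div_div_cancel₀ (hn0 _), div_div_cancel₀ (hr0 _),
    div_div_cancel₀ (mul_ne_zero (hn0 _) (hr0 _))]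

theorem mul_one_sub_inv_le {N R x y P : ℝ} (hP : 0 < P) (hy : y ∈ Set.Ioc 0 R) (hyN : y ≤ N)
    (hxy : x * y = N * R / P) : y * (1 - 1 / P) ≤ x + y - (N + R) / P := by
  have hx : x = N * R / P / y := eq_div_of_mul_eq hy.1.ne' hxy
  have hy0 : y ≠ 0 := hy.1.ne'
  have heq : x + y - (N + R) / P - y * (1 - 1 / P) = (R - y) * (N - y) / (P * y) := by
    rw [hx]
    field_simp
    ring
  exact sub_nonneg.1 (heq ▸ div_nonneg (mul_nonneg (sub_nonneg.2 hy.2) (sub_nonneg.2 hyN))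
    (mul_pos hP hy.1).le)

theorem mul_one_sub_inv_le_lowerBound {c : Fin d → ℝ} {x y : ℝ} (hP : 0 < P)
    (hA : matrixTerm n r P = ∑ k, c k) (hB : tensorTerm n r P = x + y)
    (hc : ∀ k, c k ∈ Set.Ioc 0 ((n k : ℝ) * r k))
    (hprod : (∏ k, (n k : ℝ) * r k) / P ≤ ∏ k, c k)
    (hy : y ∈ Set.Ioc 0 (∏ k, (r k : ℝ))) (hyN : y ≤ ∏ k, (n k : ℝ))
    (hxy : x * y = (∏ k, (n k : ℝ)) * (∏ k, (r k : ℝ)) / P) :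
    y * (1 - 1 / P) ≤ lowerBound n r P := by
  have hP0 : (0 : ℝ) < P := Nat.cast_pos.2 hP
  have hmatrix := sum_div_le_sum_of_prod_div_le_prod hP0 (fun k => (hc k).1)
    (fun k => (hc k).2) hprod
  have htensor := mul_one_sub_inv_le hP0 hy hyN hxy
  rw [lowerBound, owned, hA, hB, add_div]
  linarith

theorem exists_gridCost_le (hd : 1 ≤ d) (hn : ∀ k, 0 < n k) (hr : ∀ k, 0 < r k)
    (hmono : Monotone fun k => n k * r k) (hnr : ∏ k, r k ≤ ∏ k, n k) (hP : 0 < P)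
    (hPnr : P ≤ (∏ k, n k) * ∏ k, r k) :
    ∃ u ∈ Set.Icc 1 (fun k => (n k : ℝ)), ∃ v ∈ Set.Icc 1 (fun k => (r k : ℝ)),
      (∏ k, u k) * ∏ k, v k = (∏ k, (n k : ℝ)) * (∏ k, (r k : ℝ)) / P ∧
      (∏ k, v k) * (1 - 1 / P) ≤ lowerBound n r P ∧
      gridCost n r P (fun k => n k / u k) (fun k => r k / v k) ≤
        lowerBound n r P + (∏ k, v k - 1) := by
  have : Nonempty (Fin d) := ⟨⟨0, hd⟩⟩
  have hn1 (k : Fin d) : (1 : ℝ) ≤ n k := Nat.one_le_cast.2 (hn k)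
  have hr1 (k : Fin d) : (1 : ℝ) ≤ r k := Nat.one_le_cast.2 (hr k)
  set c : Fin d → ℝ := fun k => min ((n k : ℝ) * r k) (matrixCutoff n r P)
  have hA : matrixTerm n r P = ∑ k, c k := matrixTerm_eq_sum_min hd hn hr hmono hP
  have hprod : ∏ k, c k = (∏ k, (n k : ℝ) * r k) / P := prod_min_matrixCutoff hd hn hr hmono hP
  have hcutoff : 1 ≤ matrixCutoff n r P := by
    refine one_le_of_one_le_prod_min (fun k => by positivity) matrixCutoff_nonneg
      (m := fun k => (n k : ℝ) * r k) ?_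
    rw [hprod, one_le_div (Nat.cast_pos.2 hP), Finset.prod_mul_distrib]
    exact_mod_cast hPnr
  have hc1 (k : Fin d) : 1 ≤ c k := le_min (one_le_mul_of_one_le_of_one_le (hn1 k) (hr1 k)) hcutoff
  have hcm (k : Fin d) : c k ≤ n k * r k := min_le_left _ _
  obtain ⟨x, hx, y, hy, hB, hxy, hside⟩ := exists_tensorTerm_eq_add hr hnr hP hPnr
  have hy0 : 0 < y := zero_lt_one.trans_le hy.1
  obtain ⟨u, hu, v, hv, rfl, rfl, hsum⟩ := exists_sum_mul_le hn1 hr1 ⟨hc1, hcm⟩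
    (by rw [hprod, hxy, Finset.prod_mul_distrib]) hx hy (hside.imp_right fun h => by
      rw [h]
      exact Finset.prod_le_prod (fun k _ => le_min (by positivity) (zero_le_one.trans (hc1 k)))
        fun k _ => min_le_left _ _)
  refine ⟨u, hu, v, hv, hxy, ?_, ?_⟩
  · exact mul_one_sub_inv_le_lowerBound hP hA hB (fun k => ⟨zero_lt_one.trans_le (hc1 k), hcm k⟩)
      hprod.ge ⟨hy0, hy.2⟩ (hy.2.trans (by exact_mod_cast hnr)) hxy
  · rw [gridCost_div hn hr (fun k => (zero_lt_one.trans_le (hu.1 k)).ne')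
      (fun k => (zero_lt_one.trans_le (hv.1 k)).ne') hP, lowerBound, hA, hB]
    linarith

theorem exists_gridCost_le_three_mul_lowerBound (hd : 1 ≤ d) (hn : ∀ k, 0 < n k)
    (hr : ∀ k, 0 < r k) (hmono : Monotone fun k => n k * r k) (hnr : ∏ k, r k ≤ ∏ k, n k)
    (hP : 0 < P) (hPnr : P ≤ (∏ k, n k) * ∏ k, r k) :
    ∃ p q : Fin d → ℝ, (∀ k, 1 ≤ p k ∧ p k ≤ n k) ∧ (∀ k, 1 ≤ q k ∧ q k ≤ r k) ∧
      (∏ k, p k) * ∏ k, q k = P ∧ gridCost n r P p q ≤ 3 * lowerBound n r P := by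
  obtain ⟨u, hu, v, hv, huv, hLB, hcost⟩ := exists_gridCost_le hd hn hr hmono hnr hP hPnr
  rcases eq_or_lt_of_le (Nat.succ_le_of_lt hP) with rfl | hP2
  · refine ⟨1, 1, fun k => ⟨le_rfl, Nat.one_le_cast.2 (hn k)⟩,
      fun k => ⟨le_rfl, Nat.one_le_cast.2 (hr k)⟩, by simp, ?_⟩
    have hcost0 : gridCost n r 1 1 1 = 0 := by simp [gridCost, collectiveCost]
    simp only [Nat.cast_one, div_one, sub_self, mul_zero] at hLB
    linarith
  have hu0 (k : Fin d) : 0 < u k := zero_lt_one.trans_le (hu.1 k)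
  have hv0 (k : Fin d) : 0 < v k := zero_lt_one.trans_le (hv.1 k)
  refine ⟨fun k => n k / u k, fun k => r k / v k,
    fun k => ⟨(one_le_div (hu0 k)).2 (hu.2 k), div_le_self (Nat.cast_nonneg _) (hu.1 k)⟩,
    fun k => ⟨(one_le_div (hv0 k)).2 (hv.2 k), div_le_self (Nat.cast_nonneg _) (hv.1 k)⟩, ?_, ?_⟩
  · have hN : (∏ k, (n k : ℝ)) ≠ 0 :=
      Finset.prod_ne_zero_iff.2 fun k _ => (Nat.cast_pos.2 (hn k)).ne'
    have hR : (∏ k, (r k : ℝ)) ≠ 0 :=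
      Finset.prod_ne_zero_iff.2 fun k _ => (Nat.cast_pos.2 (hr k)).ne'
    rw [Finset.prod_div_distrib, Finset.prod_div_distrib, div_mul_div_comm, huv,
      div_div_cancel₀ (mul_ne_zero hN hR)]
  · have hhalf : (1 : ℝ) / P ≤ 1 / 2 :=
      one_div_le_one_div_of_le two_pos (by exact_mod_cast hP2)
    have hv1 : 0 ≤ ∏ k, v k := Finset.prod_nonneg fun k _ => (hv0 k).le
    linarith [mul_le_mul_of_nonneg_left hhalf hv1]

end GridCost

/-! ### Communication of atomic algorithms -/

section Communication

variable {d : ℕ} {n r : Fin d → ℕ} {P : ℕ}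

/-- An entry of the input tensor, of an input matrix, or of the output tensor. -/
abbrev Entry {d : ℕ} (n r : Fin d → ℕ) : Type :=
  Idx n ⊕ (Σ k : Fin d, Fin (n k) × Fin (r k)) ⊕ Idx r

/-- The entry that a word is, or is a partial sum of. -/
def Word.entry : Word n r → Entry n r
  | .x i => .inl i
  | .a k i j => .inr (.inl ⟨k, i, j⟩)
  | .part j _ => .inr (.inr j)

theorem card_entry : Fintype.card (Entry n r) = ∏ k, n k + (∑ k, n k * r k + ∏ k, r k) := by
  simp

theorem mem_update_insert {α β : Type*} [DecidableEq α] {M : α → Set β} {s t : α} {v w : β} :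
    w ∈ Function.update M s (insert v (M s)) t ↔ t = s ∧ w = v ∨ w ∈ M t := by
  rcases eq_or_ne t s with rfl | h
  · simp
  · simp [h]

namespace Layout

variable (L : Layout n r P)

/-- The processor that owns an entry. -/
def owner : Entry n r → Fin P
  | .inl i => L.ownerX i
  | .inr (.inl e) => L.ownerA e.1 e.2.1 e.2.2
  | .inr (.inr j) => L.ownerY j

/-- The entries that processor `s` owns. -/
def ownedEntries (s : Fin P) : Finset (Entry n r) := Finset.univ.filter fun e => L.owner e = s

/-- The terms computed on processor `s`. -/
def terms (s : Fin P) : Finset (Idx n × Idx r) :=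
  Finset.univ.filter fun t => L.proc t.1 t.2 = s

/-- The entries of the input tensor that occur in the terms computed on processor `s`. -/
def usedX (s : Fin P) : Finset (Idx n) := (L.terms s).image Prod.fst

/-- The entries of the `k`-th matrix that occur in the terms computed on processor `s`. -/
def usedA (s : Fin P) (k : Fin d) : Finset (Fin (n k) × Fin (r k)) :=
  (L.terms s).image fun t => (t.1 k, t.2 k)

/-- The entries of the output tensor to which the terms computed on processor `s` contribute. -/
def usedY (s : Fin P) : Finset (Idx r) := (L.terms s).image Prod.snd

/-- All entries involved in the terms computed on processor `s`. -/
def used (s : Fin P) : Finset (Entry n r) :=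
  (L.usedX s).disjSum ((Finset.univ.sigma (L.usedA s)).disjSum (L.usedY s))

/-- The entries that processor `s` owns or of which it has sent or received a word in `T`. -/
def accessible (T : List (Message n r P)) (s : Fin P) : Finset (Entry n r) :=
  L.ownedEntries s ∪
    ((T.filter fun m => m.src = s ∨ m.dst = s).map fun m => m.word.entry).toFinset

theorem exists_card_ownedEntries_le (hP : 0 < P) :
    ∃ s, ((L.ownedEntries s).card : ℝ) ≤ owned n r P := by
  have : Nonempty (Fin P) := ⟨⟨0, hP⟩⟩
  obtain ⟨s, hs⟩ := Fintype.exists_card_fiber_le_of_card_le_nsmul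
    (f := L.owner) (b := (Fintype.card (Entry n r) : ℝ) / P) (by
      rw [Fintype.card_fin, nsmul_eq_mul, mul_div_cancel₀ _ (Nat.cast_pos.2 hP).ne'])
  refine ⟨s, hs.trans_eq ?_⟩
  rw [card_entry, owned]
  push_cast
  ring

theorem card_used (s : Fin P) :
    (L.used s).card = (L.usedX s).card + (∑ k, (L.usedA s k).card + (L.usedY s).card) := by
  simp [used, Finset.card_disjSum, Finset.card_sigma]

theorem card_terms_le_usedX_mul_usedY (s : Fin P) :
    (L.terms s).card ≤ (L.usedX s).card * (L.usedY s).card := by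
  rw [← Finset.card_product]
  exact Finset.card_le_card Finset.subset_product

theorem card_terms_le_prod_usedA (s : Fin P) :
    (L.terms s).card ≤ ∏ k, (L.usedA s k).card := by
  rw [← Fintype.card_piFinset]
  refine Finset.card_le_card_of_injOn (fun t k => (t.1 k, t.2 k))
    (fun t ht => Fintype.mem_piFinset.2 fun k => Finset.mem_image_of_mem _ ht) ?_
  exact fun t _ t' _ h => Prod.ext (funext fun k => congrArg Prod.fst (congrFun h k))
    (funext fun k => congrArg Prod.snd (congrFun h k))

theorem card_usedA_le (s : Fin P) (k : Fin d) : (L.usedA s k).card ≤ n k * r k := by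
  simpa using Finset.card_le_univ (L.usedA s k)

theorem card_usedY_le (s : Fin P) : (L.usedY s).card ≤ ∏ k, r k := by
  simpa using Finset.card_le_univ (L.usedY s)

theorem LoadBalanced.lowerBound_add_owned_le {L : Layout n r P} (hL : L.LoadBalanced) (hd : 1 ≤ d)
    (hn : ∀ k, 0 < n k) (hr : ∀ k, 0 < r k) (hmono : Monotone fun k => n k * r k) (hP : 0 < P)
    (s : Fin P) : lowerBound n r P + owned n r P ≤ (L.used s).card := by
  have hcard : (L.terms s).card * P = (∏ k, n k) * ∏ k, r k := hL s
  have hterms : (∏ k, (n k : ℝ)) * (∏ k, (r k : ℝ)) / P = (L.terms s).card := by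
    rw [div_eq_iff (Nat.cast_pos.2 hP).ne']
    exact_mod_cast hcard.symm
  have hne : (L.terms s).Nonempty := Finset.card_pos.1 <| Nat.pos_of_mul_pos_right <| hcard ▸
    Nat.mul_pos (Finset.prod_pos fun k _ => hn k) (Finset.prod_pos fun k _ => hr k)
  have hA : matrixTerm n r P ≤ ∑ k, ((L.usedA s k).card : ℝ) := by
    refine matrixTerm_le_sum hd hn hr hmono hP
      (fun k => Nat.cast_pos.2 (Finset.card_pos.2 (hne.image _)))
      (fun k => by exact_mod_cast L.card_usedA_le s k) ?_
    rw [Finset.prod_mul_distrib, hterms]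
    exact_mod_cast L.card_terms_le_prod_usedA s
  have hB : tensorTerm n r P ≤ (L.usedX s).card + (L.usedY s).card := by
    refine tensorTerm_le_add hP (Nat.cast_nonneg _)
      ⟨Nat.cast_pos.2 (Finset.card_pos.2 (hne.image _)), by exact_mod_cast L.card_usedY_le s⟩ ?_
    rw [hterms]
    exact_mod_cast L.card_terms_le_usedX_mul_usedY s
  rw [lowerBound, sub_add_cancel, L.card_used]
  push_cast
  linarith

variable {L} {T : List (Message n r P)}

theorem mem_accessible {s : Fin P} {e : Entry n r} :
    e ∈ L.accessible T s ↔
      L.owner e = s ∨ ∃ m ∈ T, (m.src = s ∨ m.dst = s) ∧ m.word.entry = e := by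
  simp [accessible, ownedEntries, and_assoc]

theorem accessible_subset_cons (m : Message n r P) (s : Fin P) :
    L.accessible T s ⊆ L.accessible (m :: T) s := fun _ he =>
  mem_accessible.2 <| (mem_accessible.1 he).imp_right fun ⟨m', hm', h⟩ =>
    ⟨m', List.mem_cons_of_mem _ hm', h⟩

theorem entry_mem_accessible_cons {m : Message n r P} {s : Fin P} (h : m.src = s ∨ m.dst = s) :
    m.word.entry ∈ L.accessible (m :: T) s :=
  mem_accessible.2 (Or.inr ⟨m, List.mem_cons_self, h, rfl⟩)

variable (L T) in
theorem card_accessible_le (s : Fin P) :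
    (L.accessible T s).card ≤ (L.ownedEntries s).card + traffic T s := by
  refine (Finset.card_union_le _ _).trans (Nat.add_le_add_left ?_ _)
  rw [traffic, List.countP_eq_length_filter]
  exact (List.toFinset_card_le _).trans_eq (List.length_map _)

variable (L T) in
/-- What makes it possible that processor `s` has held a word after the messages `T`. For a partial
sum of the output entry `j`, every processor that computed one of its terms has access to the
factors of that term, and is `s` or has access to the entry `j`. -/
def Justified (s : Fin P) : Word n r → Prop
  | .x i => .inl i ∈ L.accessible T s
  | .a k i j => .inr (.inl ⟨k, i, j⟩) ∈ L.accessible T s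
  | .part j S => ∀ i ∈ S, .inl i ∈ L.accessible T (L.proc i j) ∧
      (∀ k, .inr (.inl ⟨k, i k, j k⟩) ∈ L.accessible T (L.proc i j)) ∧
      (s = L.proc i j ∨ .inr (.inr j) ∈ L.accessible T (L.proc i j))

theorem Justified.cons {s : Fin P} {w : Word n r} (h : L.Justified T s w) (m : Message n r P) :
    L.Justified (m :: T) s w := by
  cases w with
  | x i => exact accessible_subset_cons m s h
  | a k i j => exact accessible_subset_cons m s h
  | part j S =>
    intro i hi
    obtain ⟨hx, ha, hy⟩ := h i hi
    exact ⟨accessible_subset_cons m _ hx, fun k => accessible_subset_cons m _ (ha k),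
      hy.imp_right fun hy => accessible_subset_cons m _ hy⟩

theorem Justified.send {src dst : Fin P} {w : Word n r} (h : L.Justified T src w) :
    L.Justified (⟨src, dst, w⟩ :: T) dst w := by
  cases w with
  | x i => exact entry_mem_accessible_cons (Or.inr rfl)
  | a k i j => exact entry_mem_accessible_cons (Or.inr rfl)
  | part j S =>
    intro i hi
    obtain ⟨hx, ha, hy⟩ := h.cons ⟨src, dst, .part j S⟩ i hi
    exact ⟨hx, ha, Or.inr (hy.elim (fun hsrc => entry_mem_accessible_cons (Or.inl hsrc)) id)⟩

theorem Run.justified {M : Fin P → Set (Word n r)} (h : L.Run T M) {s : Fin P} {w : Word n r}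
    (hw : w ∈ M s) : L.Justified T s w := by
  induction h generalizing s w with
  | start => rcases hw with ⟨i, hi, rfl⟩ | ⟨k, i, j, hi, rfl⟩ <;> exact mem_accessible.2 (Or.inl hi)
  | compute i j _ hx ha ih =>
    rcases mem_update_insert.1 hw with ⟨rfl, rfl⟩ | hw
    · intro i' hi'
      obtain rfl := Finset.mem_singleton.1 hi'
      exact ⟨ih hx, fun k => ih (ha k), Or.inl rfl⟩
    · exact ih hw
  | add s j S₁ S₂ _ h₁ h₂ _ ih =>
    rcases mem_update_insert.1 hw with ⟨rfl, rfl⟩ | hw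
    · exact fun i hi => (Finset.mem_disjUnion.1 hi).elim (ih h₁ i) (ih h₂ i)
    · exact ih hw
  | send src dst v _ _ hv ih =>
    rcases mem_update_insert.1 hw with ⟨rfl, rfl⟩ | hw
    · exact (ih hv).send
    · exact (ih hw).cons _

theorem Computes.used_subset_accessible (h : L.Computes T) (s : Fin P) :
    L.used s ⊆ L.accessible T s := by
  obtain ⟨M, hrun, hM⟩ := h
  have hterm {t : Idx n × Idx r} (ht : t ∈ L.terms s) :
      .inl t.1 ∈ L.accessible T s ∧ (∀ k, .inr (.inl ⟨k, t.1 k, t.2 k⟩) ∈ L.accessible T s) ∧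
        (L.ownerY t.2 = s ∨ .inr (.inr t.2) ∈ L.accessible T s) :=
    (Finset.mem_filter.1 ht).2 ▸ hrun.justified (hM t.2) t.1 (Finset.mem_univ _)
  rintro (i | ⟨k, a⟩ | j) he
  · obtain ⟨t, ht, rfl⟩ := Finset.mem_image.1 (Finset.inl_mem_disjSum.1 he)
    exact (hterm ht).1
  · have ha : a ∈ L.usedA s k := (Finset.mem_sigma.1
      (Finset.inl_mem_disjSum.1 (Finset.inr_mem_disjSum.1 he))).2
    obtain ⟨t, ht, rfl⟩ := Finset.mem_image.1 ha
    exact (hterm ht).2.1 k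
  · obtain ⟨t, ht, rfl⟩ := Finset.mem_image.1
      (Finset.inr_mem_disjSum.1 (Finset.inr_mem_disjSum.1 he))
    exact (hterm ht).2.2.elim (fun howner => mem_accessible.2 (Or.inl howner)) id

theorem exists_lowerBound_le_traffic (hd : 1 ≤ d) (hn : ∀ k, 0 < n k) (hr : ∀ k, 0 < r k)
    (hmono : Monotone fun k => n k * r k) (hP : 0 < P) (hL : L.LoadBalanced) (hT : L.Computes T) :
    ∃ s : Fin P, lowerBound n r P ≤ traffic T s := by
  obtain ⟨s, hs⟩ := L.exists_card_ownedEntries_le hP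
  have hused : ((L.used s).card : ℝ) ≤ (L.ownedEntries s).card + traffic T s := by
    exact_mod_cast (Finset.card_le_card (hT.used_subset_accessible s)).trans
      (L.card_accessible_le T s)
  exact ⟨s, by linarith [hL.lowerBound_add_owned_le hd hn hr hmono hP s]⟩

end Layout

end Communication

/-! ### The grid algorithm -/

section GridAlgorithm

theorem card_block_mul {m b : ℕ} (h : b ∣ m) (c : Fin b) : (block m b c).card * b = m := by
  have hm : (c.val + 1) * (m / b) ≤ m := calc
    (c.val + 1) * (m / b) ≤ b * (m / b) := Nat.mul_le_mul_right _ c.isLt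
    _ = m := Nat.mul_div_cancel' h
  have hIco : (block m b c).map Fin.valEmbedding =
      Finset.Ico (c.val * (m / b)) ((c.val + 1) * (m / b)) := by
    ext a
    simp only [block, Finset.mem_map, Finset.mem_filter_univ, Fin.valEmbedding_apply,
      Finset.mem_Ico]
    exact ⟨fun ⟨_, hi, hia⟩ => hia ▸ hi, fun ha => ⟨⟨a, ha.2.trans_le hm⟩, ha, rfl⟩⟩
  rw [← Finset.card_map Fin.valEmbedding, hIco, Nat.card_Ico, add_mul, one_mul,
    Nat.add_sub_cancel_left, Nat.div_mul_cancel h]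

theorem mem_block {m b : ℕ} (hmb : 0 < m / b) {i : Fin m} {c : Fin b} :
    i ∈ block m b c ↔ i.val / (m / b) = c.val := by
  rw [Nat.div_eq_iff hmb, block, Finset.mem_filter_univ, add_mul, one_mul]
  omega

theorem existsUnique_mem_block {m b : ℕ} (h : b ∣ m) (i : Fin m) :
    ∃! c : Fin b, i ∈ block m b c := by
  have hmb : 0 < m / b := Nat.div_pos (Nat.le_of_dvd i.pos h) (Nat.pos_of_dvd_of_pos h i.pos)
  have hlt : i.val / (m / b) < b := by
    rw [Nat.div_lt_iff_lt_mul hmb, Nat.mul_div_cancel' h]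
    exact i.isLt
  exact ⟨⟨_, hlt⟩, (mem_block hmb).2 rfl, fun c hc => Fin.ext ((mem_block hmb).1 hc).symm⟩

variable {d : ℕ} {n r p q : Fin d → ℕ}

theorem card_piFinset_block_mul_prod (hp : ∀ k, p k ∣ n k) (s : Idx p) :
    (Fintype.piFinset fun k => block (n k) (p k) (s k)).card * ∏ k, p k = ∏ k, n k := by
  rw [Fintype.card_piFinset, ← Finset.prod_mul_distrib]
  exact Finset.prod_congr rfl fun k _ => card_block_mul (hp k) (s k)

theorem existsUnique_mem_piFinset_block (hp : ∀ k, p k ∣ n k) (i : Idx n) :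
    ∃! s : Idx p, i ∈ Fintype.piFinset fun k => block (n k) (p k) (s k) := by
  choose c hc hu using fun k => existsUnique_mem_block (hp k) (i k)
  exact ⟨c, Fintype.mem_piFinset.2 hc,
    fun s hs => funext fun k => hu k _ (Fintype.mem_piFinset.1 hs k)⟩

theorem existsUnique_gridProc (hp : ∀ k, p k ∣ n k) (hq : ∀ k, q k ∣ r k) (i : Idx n) (j : Idx r) :
    ∃! s : GridProc p q, i ∈ blockX n s ∧ j ∈ blockY r s := by
  obtain ⟨a, ha, hau⟩ := existsUnique_mem_piFinset_block hp i
  obtain ⟨b, hb, hbu⟩ := existsUnique_mem_piFinset_block hq j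
  exact ⟨(a, b), ⟨ha, hb⟩, fun s hs => Prod.ext (hau _ hs.1) (hbu _ hs.2)⟩

theorem card_blockX_mul_card_blockY (hp : ∀ k, p k ∣ n k) (hq : ∀ k, q k ∣ r k)
    (s : GridProc p q) :
    (blockX n s).card * (blockY r s).card * ((∏ k, p k) * ∏ k, q k) =
      (∏ k, n k) * ∏ k, r k := by
  rw [blockX, blockY, mul_mul_mul_comm, card_piFinset_block_mul_prod hp,
    card_piFinset_block_mul_prod hq]

theorem card_blockA_mul (hp : ∀ k, p k ∣ n k) (hq : ∀ k, q k ∣ r k) (k : Fin d)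
    (s : GridProc p q) : (blockA n r k s).card * (p k * q k) = n k * r k := by
  rw [blockA, Finset.card_product, mul_mul_mul_comm, card_block_mul (hp k), card_block_mul (hq k)]

theorem groupX_eq (s : GridProc p q) : groupX s = {s.1} ×ˢ Finset.univ := by
  ext
  simp only [groupX, Finset.mem_filter_univ, Finset.mem_product, Finset.mem_singleton,
    Finset.mem_univ, and_true]

theorem groupY_eq (s : GridProc p q) : groupY s = Finset.univ ×ˢ {s.2} := by
  ext
  simp only [groupY, Finset.mem_filter_univ, Finset.mem_product, Finset.mem_singleton,
    Finset.mem_univ, true_and]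

theorem groupA_eq (k : Fin d) (s : GridProc p q) :
    groupA k s = (Finset.univ.filter fun a : Idx p => a k = s.1 k) ×ˢ
      (Finset.univ.filter fun b : Idx q => b k = s.2 k) := by
  ext
  simp [groupA]

theorem card_groupX_mul_prod (s : GridProc p q) :
    (groupX s).card * ∏ k, p k = (∏ k, p k) * ∏ k, q k := by
  simp [groupX_eq, mul_comm]

theorem card_groupY_mul_prod (s : GridProc p q) :
    (groupY s).card * ∏ k, q k = (∏ k, p k) * ∏ k, q k := by
  simp [groupY_eq]

theorem card_filter_apply_eq_mul (k : Fin d) (c : Fin (p k)) :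
    (Finset.univ.filter fun a : Idx p => a k = c).card * p k = ∏ j, p j := by
  have hcard := Fintype.card_filter_piFinset_eq_of_mem (fun j => (Finset.univ : Finset (Fin (p j))))
    k (Finset.mem_univ c)
  simp only [Fintype.piFinset_univ, Finset.card_univ, Fintype.card_fin] at hcard
  rw [hcard, Finset.prod_erase_mul _ _ (Finset.mem_univ k)]

theorem card_groupA_mul (k : Fin d) (s : GridProc p q) :
    (groupA k s).card * (p k * q k) = (∏ j, p j) * ∏ j, q j := by
  rw [groupA_eq, Finset.card_product, mul_mul_mul_comm, card_filter_apply_eq_mul,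
    card_filter_apply_eq_mul]

theorem gridAlgorithmOutput_eq_multiTTM (hp : ∀ k, p k ∣ n k) (X : Idx n → ℝ)
    (A : ∀ k : Fin d, Matrix (Fin (n k)) (Fin (r k)) ℝ) (s : GridProc p q) (j : Idx r) :
    gridAlgorithmOutput X A s j = multiTTM X A j := by
  have hcover : (Finset.univ.biUnion fun a : Idx p => blockX n (a, s.2)) = Finset.univ :=
    Finset.eq_univ_of_forall fun i => by
      obtain ⟨a, ha, -⟩ := existsUnique_mem_piFinset_block hp i
      exact Finset.mem_biUnion.2 ⟨a, Finset.mem_univ a, ha⟩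
  have hdisj : ((Finset.univ : Finset (Idx p)) : Set (Idx p)).PairwiseDisjoint
      fun a => blockX n (a, s.2) := fun a _ b _ hab =>
    Finset.disjoint_left.2 fun i ha hb =>
      hab ((existsUnique_mem_piFinset_block hp i).unique ha hb)
  rw [gridAlgorithmOutput, groupY_eq, Finset.sum_product]
  simp only [Finset.sum_singleton, localMultiTTM]
  rw [← Finset.sum_biUnion hdisj, hcover, multiTTM]

theorem lineCost_eq_of_mul_eq [Nonempty (GridProc p q)]
    {group : GridProc p q → Finset (GridProc p q)} {words : GridProc p q → ℕ} {K b w : ℕ}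
    (hb : b ≠ 0) (hgroup : ∀ s, (group s).card * b = K) (hwords : ∀ s, words s * b = w) :
    lineCost group words = collectiveCost (K / b) (w / b) := by
  have hb0 : (b : ℝ) ≠ 0 := Nat.cast_ne_zero.2 hb
  have hQ (s : GridProc p q) : ((group s).card : ℝ) = K / b :=
    eq_div_of_mul_eq hb0 (by exact_mod_cast hgroup s)
  have hw (s : GridProc p q) : (words s : ℝ) = w / b :=
    eq_div_of_mul_eq hb0 (by exact_mod_cast hwords s)
  simp only [lineCost, hQ, hw, ciSup_const]

theorem gridAlgorithmCost_eq_gridCost (hn : ∀ k, 0 < n k) (hr : ∀ k, 0 < r k)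
    (hp : ∀ k, p k ∣ n k) (hq : ∀ k, q k ∣ r k) :
    gridAlgorithmCost n r p q =
      gridCost n r ((∏ k, p k) * ∏ k, q k) (fun k => p k) (fun k => q k) := by
  have hp0 (k : Fin d) : p k ≠ 0 := (Nat.pos_of_dvd_of_pos (hp k) (hn k)).ne'
  have hq0 (k : Fin d) : q k ≠ 0 := (Nat.pos_of_dvd_of_pos (hq k) (hr k)).ne'
  have : Nonempty (GridProc p q) :=
    ⟨(fun k => ⟨0, Nat.pos_of_ne_zero (hp0 k)⟩, fun k => ⟨0, Nat.pos_of_ne_zero (hq0 k)⟩)⟩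
  have hX := lineCost_eq_of_mul_eq (Finset.prod_ne_zero_iff.2 fun k _ => hp0 k)
    card_groupX_mul_prod fun s : GridProc p q => card_piFinset_block_mul_prod hp s.1
  have hA (k : Fin d) := lineCost_eq_of_mul_eq (mul_ne_zero (hp0 k) (hq0 k))
    (card_groupA_mul k) (card_blockA_mul hp hq k)
  have hY := lineCost_eq_of_mul_eq (Finset.prod_ne_zero_iff.2 fun k _ => hq0 k)
    card_groupY_mul_prod fun s : GridProc p q => card_piFinset_block_mul_prod hq s.2
  unfold gridAlgorithmCost blockX blockY gridCost
  simp only [hX, hA, hY]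
  push_cast
  rfl

end GridAlgorithm

end MultiTTM

open MultiTTM in
theorem theorem7p1 {d : ℕ} (hd : 1 ≤ d) (n r : Fin d → ℕ)
    (hn : ∀ k, 2 ≤ n k) (hr : ∀ k, 2 ≤ r k)
    (hmono : Monotone fun k => n k * r k)
    (hnr : ∏ k, r k ≤ ∏ k, n k)
    (P : ℕ) (hP : 1 ≤ P) (hPnr : P ≤ (∏ k, n k) * ∏ k, r k) :
    -- `lowerBound` bounds the communication of every load balanced atomic algorithm
    (∀ (L : Layout n r P) (T : List (Message n r P)), L.LoadBalanced → L.Computes T →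
      ∃ s : Fin P, lowerBound n r P ≤ traffic T s) ∧
    -- on every integral grid the algorithm is atomic, load balanced and correct, and has cost
    -- `gridCost`
    (∀ p q : Fin d → ℕ, (∀ k, p k ∣ n k) → (∀ k, q k ∣ r k) → (∏ k, p k) * ∏ k, q k = P →
      (∀ (i : Idx n) (j : Idx r), ∃! s : GridProc p q, i ∈ blockX n s ∧ j ∈ blockY r s) ∧
      (∀ s : GridProc p q,
        (blockX n s).card * (blockY r s).card * P = (∏ k, n k) * ∏ k, r k) ∧
      (∀ (X : Idx n → ℝ) (A : ∀ k : Fin d, Matrix (Fin (n k)) (Fin (r k)) ℝ)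
        (s : GridProc p q), ∀ j ∈ blockY r s,
          gridAlgorithmOutput X A s j = multiTTM X A j) ∧
      gridAlgorithmCost n r p q = gridCost n r P (fun k => p k) (fun k => q k)) ∧
    -- some grid is optimal up to a factor of three
    ∃ p q : Fin d → ℝ,
      (∀ k, 1 ≤ p k ∧ p k ≤ n k) ∧ (∀ k, 1 ≤ q k ∧ q k ≤ r k) ∧
      (∏ k, p k) * ∏ k, q k = P ∧
      gridCost n r P p q =
        (∏ k, (n k : ℝ)) / ∏ k, p k + (∏ k, (r k : ℝ)) / ∏ k, q k +
          ∑ k, (n k : ℝ) * r k / (p k * q k) - owned n r P ∧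
      gridCost n r P p q ≤ 3 * lowerBound n r P := by
  have hn0 (k : Fin d) : 0 < n k := two_pos.trans_le (hn k)
  have hr0 (k : Fin d) : 0 < r k := two_pos.trans_le (hr k)
  refine ⟨fun L T hL hT => Layout.exists_lowerBound_le_traffic hd hn0 hr0 hmono hP hL hT,
    fun p q hp hq hpq => ?_, ?_⟩
  · subst hpq
    exact ⟨existsUnique_gridProc hp hq, card_blockX_mul_card_blockY hp hq,
      fun X A s j _ => gridAlgorithmOutput_eq_multiTTM hp X A s j,
      gridAlgorithmCost_eq_gridCost hn0 hr0 hp hq⟩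
  · obtain ⟨p, q, hp, hq, hpq, hle⟩ :=
      exists_gridCost_le_three_mul_lowerBound hd hn0 hr0 hmono hnr hP hPnr
    exact ⟨p, q, hp, hq, hpq, gridCost_eq (fun k => (one_pos.trans_le (hp k).1).ne')
      (fun k => (one_pos.trans_le (hq k).1).ne') hP, hle⟩
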